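/- **Theorem 1.** For a $2\pi$-periodic measurable function $f$ let $\|f\|_p=\big(\int_0^{2\pi}|f(t)|^p\,dt\big)^{1/p}$ if $1\le p<\infty$ and $\|f\|_\infty=\operatorname{ess\,sup}_t|f(t)|$; we put $1/p=0$ for $p=\infty$. Given real numbers $\beta_k$ and $\psi(k)>0$ ($k\ge1$) with $$\sum_{k=1}^\infty\psi(k)<\infty,\tag{1}$$ put $\Psi_{\bar\beta}(t)=\sum_{k=1}^\infty\psi(k)\cos\big(kt-\tfrac{\pi\beta_k}{2}\big)$, and let $C^\psi_{\bar\beta,1}$ be the class of all functions $$f(x)=\frac{a_0}{2}+\frac1\pi\int_0^{2\pi}\Psi_{\bar\beta}(x-t)\varphi(t)\,dt\qquad(x\in\mathbb R),$$ where $a_0\in\mathbb R$ and $\varphi$ is a real-valued $2\pi$-periodic summable function with $\int_0^{2\pi}\varphi(t)\,dt=0$ and $\|\varphi\|_1\le1$. For $n\in\mathbb N$, $n\ge1$, let $\tilde S_{n-1}(f;\cdot)$ be the unique trigonometric polynomial of order at most $n-1$ with $\tilde S_{n-1}(f;x_k)=f(x_k)$ at all nodes $x_k=\frac{2k\pi}{2n-1}$,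 $k\in\mathbb Z$, and let $$\tilde{\mathcal E}_n(C^\psi_{\bar\beta,1})_{L_p}=\sup_{f\in C^\psi_{\bar\beta,1}}\|f-\tilde S_{n-1}(f;\cdot)\|_p .$$ There is an absolute constant $C$ such that for all $1\le p\le\infty$, all real sequences $(\beta_k)$, all $\psi(k)>0$ satisfying (1), and all $n\ge1$, the quantity $\tilde{\mathcal E}_n(C^\psi_{\bar\beta,1})_{L_p}$ is finite and $$\left|\tilde{\mathcal E}_n(C^\psi_{\bar\beta,1})_{L_p}-\frac{2^{1-1/p}}{\pi^{1+1/p}}\|\cos t\|_p^2\,\psi(n)\right|\le C\left(\frac{\psi(n)}n+\sum_{\nu=n+1}^\infty\psi(\nu)\right).\tag{2}$$ If moreover $\lim_{k\to\infty}\psi(k+1)/\psi(k)=0$, then (2) is an asymptotic equality as $n\to\infty$: the right-hand side of (2) is $o(\psi(n))$, and $$\tilde{\mathcal E}_n(C^\psi_{\bar\beta,1})_{L_p}\sim\frac{2^{1-1/p}}{\pi^{1+1/p}}\|\cos t\|_p^2\,\psi(n),\qquad n\to\infty .$$ -/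

import Mathlib

open MeasureTheory

noncomputable section

namespace TrigInterp

/-- The standard norm of `L_p` for `2π`-periodic functions:
`(∫_0^{2π} |f|^p)^{1/p}` for `p < ∞` and the essential supremum of `|f|` for `p = ∞`. -/
def normLp (p : ENNReal) (f : ℝ → ℝ) : ENNReal :=
  eLpNorm f p (volume.restrict (Set.Ico 0 (2 * Real.pi)))

/-- The kernel `Ψ_β(t) = ∑_{k ≥ 1} ψ(k) cos(k t - π β_k / 2)`.
Only the values of `ψ` and `β` at `k ≥ 1` matter. -/
def kernel (ψ β : ℕ → ℝ) (t : ℝ) : ℝ :=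
  ∑' k : ℕ, ψ (k + 1) * Real.cos (((k + 1 : ℕ) : ℝ) * t - Real.pi * β (k + 1) / 2)

/-- The class `C^ψ_{β,1}`: functions `f(x) = a₀/2 + (1/π) ∫_0^{2π} Ψ_β(x - t) φ(t) dt`, where
`a₀` is real, `φ` is `2π`-periodic and summable, `φ ⊥ 1` and `‖φ‖₁ ≤ 1`. -/
def convClass (ψ β : ℕ → ℝ) : Set (ℝ → ℝ) :=
  {f | ∃ (a₀ : ℝ) (φ : ℝ → ℝ), Function.Periodic φ (2 * Real.pi) ∧
    IntegrableOn φ (Set.Ico 0 (2 * Real.pi)) volume ∧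
    (∫ t in (0 : ℝ)..(2 * Real.pi), φ t) = 0 ∧
    normLp 1 φ ≤ 1 ∧
    ∀ x : ℝ, f x = a₀ / 2 +
      1 / Real.pi * ∫ t in (0 : ℝ)..(2 * Real.pi), kernel ψ β (x - t) * φ t}

/-- Real trigonometric polynomials of order (at most) `m`. -/
def IsTrigPoly (m : ℕ) (T : ℝ → ℝ) : Prop :=
  ∃ a b : ℕ → ℝ, ∀ x : ℝ, T x = a 0 / 2 +
    ∑ k ∈ Finset.Icc 1 m, (a k * Real.cos (k * x) + b k * Real.sin (k * x))

/-- The node `x_k^{(n-1)} = 2kπ/(2n-1)`. -/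
def node (n : ℕ) (k : ℤ) : ℝ := 2 * k * Real.pi / (2 * n - 1)

/-- `T` is a trigonometric polynomial of order `n - 1` interpolating `f` at all the nodes. -/
def IsInterpolant (n : ℕ) (f T : ℝ → ℝ) : Prop :=
  IsTrigPoly (n - 1) T ∧ ∀ k : ℤ, T (node n k) = f (node n k)

/-- The interpolation trigonometric polynomial `S̃_{n-1}(f; ·)`: for `n ≥ 1` and a `2π`-periodic
`f`, the one function satisfying `IsInterpolant n f` (see `existsUnique_interpolant`). -/
def interp (n : ℕ) (f : ℝ → ℝ) : ℝ → ℝ := Classical.epsilon (IsInterpolant n f)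

/-- The exact upper bound over the class `C^ψ_{β,1}` of the `L_p`-norms `‖f - S̃_{n-1}(f)‖_p`. -/
def worstError (ψ β : ℕ → ℝ) (p : ENNReal) (n : ℕ) : ENNReal :=
  ⨆ f ∈ convClass ψ β, normLp p (fun x => f x - interp n f x)

/-- The constant `2^{1-1/p} / π^{1+1/p} * ‖cos‖_p²`, with `1/p = 0` for `p = ∞`. -/
def mainConst (p : ENNReal) : ℝ :=
  (2 : ℝ) ^ (1 - (p⁻¹).toReal) / Real.pi ^ (1 + (p⁻¹).toReal) * (normLp p Real.cos).toReal ^ 2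

/-! Existence and uniqueness of the interpolation polynomial. -/

theorem dirichlet_closed (m : ℕ) (y : ℝ) :
    Real.sin (y / 2) * (1 + 2 * ∑ k ∈ Finset.Icc 1 m, Real.cos (k * y)) =
      Real.sin ((2 * m + 1) * y / 2) := by
  induction m with
  | zero => simp
  | succ m ih =>
    rw [Finset.sum_Icc_succ_top (by omega), mul_add 2, ← add_assoc, mul_add, ih]
    have h1 : (2 * ((m + 1 : ℕ) : ℝ) + 1) * y / 2 = ((m + 1 : ℕ) : ℝ) * y + y / 2 := by
      push_cast; ring
    have h2 : (2 * (m : ℝ) + 1) * y / 2 = ((m + 1 : ℕ) : ℝ) * y - y / 2 := by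
      push_cast; ring
    rw [h1, h2, Real.sin_add, Real.sin_sub]
    ring

theorem dirichlet_zero (m : ℕ) (i j : Fin (2 * m + 1)) (hij : i ≠ j) :
    (1 + 2 * ∑ k ∈ Finset.Icc 1 m,
      Real.cos (k * (2 * (i : ℝ) * Real.pi / (2 * m + 1) - 2 * (j : ℝ) * Real.pi / (2 * m + 1))))
      = 0 := by
  have hN : (0 : ℝ) < 2 * m + 1 := by positivity
  have hc := dirichlet_closed m
    (2 * (i : ℝ) * Real.pi / (2 * m + 1) - 2 * (j : ℝ) * Real.pi / (2 * m + 1))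
  have h1 : (2 * (m : ℝ) + 1) *
      (2 * (i : ℝ) * Real.pi / (2 * m + 1) - 2 * (j : ℝ) * Real.pi / (2 * m + 1)) / 2
      = (((i : ℕ) : ℤ) - ((j : ℕ) : ℤ) : ℤ) * Real.pi := by
    push_cast; field_simp
  rw [h1, Real.sin_int_mul_pi] at hc
  refine (mul_eq_zero.mp hc).resolve_left ?_
  intro hs
  obtain ⟨q, hq⟩ := Real.sin_eq_zero_iff.mp hs
  have h2 : (q : ℝ) * (2 * m + 1) = (i : ℝ) - (j : ℝ) := by
    have hpi := Real.pi_ne_zero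
    have h3 : (q : ℝ) * (2 * m + 1) * Real.pi = ((i : ℝ) - (j : ℝ)) * Real.pi := by
      rw [mul_right_comm, hq]; field_simp
    exact mul_right_cancel₀ hpi h3
  have h4 : q * (2 * (m : ℤ) + 1) = ((i : ℕ) : ℤ) - ((j : ℕ) : ℤ) := by exact_mod_cast h2
  have hi := i.2
  have hj := j.2
  have hne : (i : ℕ) ≠ (j : ℕ) := fun h => hij (Fin.ext h)
  rcases lt_trichotomy q 0 with h | h | h
  · nlinarith
  · subst h; omega
  · nlinarith

/-- The values at the `2m+1` nodes as a linear function of the coefficients. -/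
def evalNodes (m : ℕ) : (Unit ⊕ (Fin m ⊕ Fin m) → ℝ) →ₗ[ℝ] (Fin (2 * m + 1) → ℝ) where
  toFun c j := c (Sum.inl ()) + ∑ k : Fin m,
    (c (Sum.inr (Sum.inl k)) *
      Real.cos ((((k : ℕ) + 1 : ℕ) : ℝ) * (2 * (j : ℝ) * Real.pi / (2 * m + 1))) +
     c (Sum.inr (Sum.inr k)) *
      Real.sin ((((k : ℕ) + 1 : ℕ) : ℝ) * (2 * (j : ℝ) * Real.pi / (2 * m + 1))))
  map_add' c d := by
    ext j
    simp only [Pi.add_apply, add_mul, Finset.sum_add_distrib]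
    ring
  map_smul' r c := by
    ext j
    simp only [Pi.smul_apply, smul_eq_mul, RingHom.id_apply, mul_add, Finset.mul_sum, mul_assoc]

theorem sum_Icc_eq_sum_fin (m : ℕ) (g : ℕ → ℝ) :
    ∑ k ∈ Finset.Icc 1 m, g k = ∑ k : Fin m, g ((k : ℕ) + 1) := by
  rw [Fin.sum_univ_eq_sum_range (fun k => g (k + 1)), Finset.range_eq_Ico,
    Finset.sum_Ico_add' g 0 m 1]
  rfl

theorem evalNodes_surjective (m : ℕ) : Function.Surjective (evalNodes m) := by
  intro v
  have hN : (0 : ℝ) < 2 * m + 1 := by positivity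
  let x : Fin (2 * m + 1) → ℝ := fun i => 2 * (i : ℝ) * Real.pi / (2 * m + 1)
  refine ⟨Sum.elim (fun _ => (∑ i, v i) / (2 * m + 1)) (Sum.elim
    (fun k => ∑ i, 2 / (2 * m + 1) * v i * Real.cos ((((k : ℕ) + 1 : ℕ) : ℝ) * x i))
    (fun k => ∑ i, 2 / (2 * m + 1) * v i * Real.sin ((((k : ℕ) + 1 : ℕ) : ℝ) * x i))), ?_⟩
  ext j
  have key : ∑ i, v i * (1 + 2 * ∑ k ∈ Finset.Icc 1 m, Real.cos (k * (x j - x i)))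
      = v j * (2 * m + 1) := by
    rw [Finset.sum_eq_single j]
    · simp
      left
      ring
    · intro i _ hi
      rw [dirichlet_zero m j i (Ne.symm hi), mul_zero]
    · simp
  have key2 : v j = (∑ i, v i * (1 + 2 * ∑ k ∈ Finset.Icc 1 m, Real.cos (k * (x j - x i))))
      / (2 * m + 1) := by
    rw [key]; field_simp
  rw [key2]
  simp only [evalNodes, LinearMap.coe_mk, AddHom.coe_mk, Sum.elim_inl, Sum.elim_inr]
  simp only [mul_add, mul_one, Finset.sum_add_distrib, add_div]
  congr 1
  rw [← Finset.sum_add_distrib, Finset.sum_div]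
  have h : ∀ i, v i * (2 * ∑ k ∈ Finset.Icc 1 m, Real.cos (k * (x j - x i))) / (2 * m + 1) =
      ∑ k : Fin m, (2 / (2 * m + 1) * v i * Real.cos ((((k : ℕ) + 1 : ℕ) : ℝ) * x i) *
        Real.cos ((((k : ℕ) + 1 : ℕ) : ℝ) * x j) +
        2 / (2 * m + 1) * v i * Real.sin ((((k : ℕ) + 1 : ℕ) : ℝ) * x i) *
        Real.sin ((((k : ℕ) + 1 : ℕ) : ℝ) * x j)) := by
    intro i
    rw [sum_Icc_eq_sum_fin m (fun k => Real.cos (k * (x j - x i))), Finset.mul_sum,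
      Finset.mul_sum, Finset.sum_div]
    refine Finset.sum_congr rfl fun k _ => ?_
    rw [mul_sub, Real.cos_sub]
    ring
  rw [Finset.sum_congr rfl (fun i _ => h i), Finset.sum_comm]
  refine Finset.sum_congr rfl fun k _ => ?_
  rw [Finset.sum_add_distrib, Finset.sum_mul, Finset.sum_mul]

theorem evalNodes_injective (m : ℕ) : Function.Injective (evalNodes m) := by
  refine (LinearMap.injective_iff_surjective_of_finrank_eq_finrank ?_).mpr
    (evalNodes_surjective m)
  simp
  omega

theorem node_succ (m : ℕ) (k : ℤ) : node (m + 1) k = 2 * k * Real.pi / (2 * m + 1) := by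
  unfold node
  congr 1
  push_cast
  ring

theorem isTrigPoly_iff (m : ℕ) (T : ℝ → ℝ) : IsTrigPoly m T ↔
    ∃ c : Unit ⊕ (Fin m ⊕ Fin m) → ℝ, ∀ x : ℝ, T x = c (Sum.inl ()) + ∑ k : Fin m,
      (c (Sum.inr (Sum.inl k)) * Real.cos ((((k : ℕ) + 1 : ℕ) : ℝ) * x) +
       c (Sum.inr (Sum.inr k)) * Real.sin ((((k : ℕ) + 1 : ℕ) : ℝ) * x)) := by
  constructor
  · rintro ⟨a, b, h⟩
    refine ⟨Sum.elim (fun _ => a 0 / 2) (Sum.elim (fun k => a (k + 1)) (fun k => b (k + 1))), ?_⟩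
    intro x
    rw [h x, sum_Icc_eq_sum_fin m (fun k => a k * Real.cos (k * x) + b k * Real.sin (k * x))]
    simp
  · rintro ⟨c, h⟩
    refine ⟨fun k => if k = 0 then 2 * c (Sum.inl ()) else
        if hk : k - 1 < m then c (Sum.inr (Sum.inl ⟨k - 1, hk⟩)) else 0,
      fun k => if hk : k - 1 < m then c (Sum.inr (Sum.inr ⟨k - 1, hk⟩)) else 0, ?_⟩
    intro x
    rw [h x, sum_Icc_eq_sum_fin m]
    simp

theorem IsTrigPoly.periodic {m : ℕ} {T : ℝ → ℝ} (hT : IsTrigPoly m T) :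
    Function.Periodic T (2 * Real.pi) := by
  obtain ⟨a, b, h⟩ := hT
  intro x
  rw [h, h]
  congr 1
  refine Finset.sum_congr rfl fun k _ => ?_
  rw [mul_add, Real.cos_add_nat_mul_two_pi, Real.sin_add_nat_mul_two_pi]

/-- Every `2π`-periodic function has exactly one interpolation polynomial of order `n - 1`. -/
theorem existsUnique_interpolant {n : ℕ} (hn : 1 ≤ n) {f : ℝ → ℝ}
    (hf : Function.Periodic f (2 * Real.pi)) : ∃! T : ℝ → ℝ, IsInterpolant n f T := by
  obtain ⟨m, rfl⟩ : ∃ m, n = m + 1 := ⟨n - 1, by omega⟩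
  have hnode : ∀ j : Fin (2 * m + 1),
      node (m + 1) ((j : ℕ) : ℤ) = 2 * (j : ℝ) * Real.pi / (2 * m + 1) := by
    intro j
    rw [node_succ]
    push_cast
    rfl
  obtain ⟨c, hc⟩ := evalNodes_surjective m (fun j => f (node (m + 1) ((j : ℕ) : ℤ)))
  refine ⟨fun x => c (Sum.inl ()) + ∑ k : Fin m,
      (c (Sum.inr (Sum.inl k)) * Real.cos ((((k : ℕ) + 1 : ℕ) : ℝ) * x) +
       c (Sum.inr (Sum.inr k)) * Real.sin ((((k : ℕ) + 1 : ℕ) : ℝ) * x)), ?_, ?_⟩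
  · have hT := (isTrigPoly_iff m _).mpr ⟨c, fun x => rfl⟩
    refine ⟨hT, ?_⟩
    intro k
    have hpos : (0 : ℤ) < 2 * m + 1 := by positivity
    have hlt : (k % (2 * m + 1)).toNat < 2 * m + 1 := by
      have h1 := Int.emod_lt_of_pos k hpos
      have h2 := Int.emod_nonneg k hpos.ne'
      omega
    have hr : (((k % (2 * m + 1)).toNat : ℕ) : ℤ) = k % (2 * m + 1) :=
      Int.toNat_of_nonneg (Int.emod_nonneg k hpos.ne')
    have hk : node (m + 1) k =
        node (m + 1) (k % (2 * m + 1)) + ((k / (2 * m + 1) : ℤ) : ℝ) * (2 * Real.pi) := by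
      have h0 : (k : ℝ) = ((k % (2 * m + 1) : ℤ) : ℝ)
          + (2 * m + 1) * ((k / (2 * m + 1) : ℤ) : ℝ) := by
        have := Int.emod_add_mul_ediv k (2 * m + 1)
        exact_mod_cast this.symm
      have hN : (2 * (m : ℝ) + 1) ≠ 0 := by positivity
      rw [node_succ, node_succ]
      rw [h0]
      field_simp
    rw [hk, hT.periodic.int_mul, hf.int_mul]
    have := congrFun hc ⟨(k % (2 * m + 1)).toNat, hlt⟩
    rw [← hr]
    rw [← this, hnode ⟨(k % (2 * m + 1)).toNat, hlt⟩]
    rfl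
  · rintro S ⟨hS, hSi⟩
    obtain ⟨d, hd⟩ := (isTrigPoly_iff m S).mp hS
    have hdc : d = c := by
      apply evalNodes_injective m
      rw [hc]
      ext j
      rw [← hSi, hd, hnode]
      rfl
    subst hdc
    funext x
    exact hd x

theorem interp_spec {n : ℕ} (hn : 1 ≤ n) {f : ℝ → ℝ}
    (hf : Function.Periodic f (2 * Real.pi)) : IsInterpolant n f (interp n f) :=
  Classical.epsilon_spec (existsUnique_interpolant hn hf).exists

theorem kernel_periodic (ψ β : ℕ → ℝ) : Function.Periodic (kernel ψ β) (2 * Real.pi) := by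
  intro t
  unfold kernel
  refine tsum_congr fun k => ?_
  have h : ((k + 1 : ℕ) : ℝ) * (t + 2 * Real.pi) - Real.pi * β (k + 1) / 2 =
      (((k + 1 : ℕ) : ℝ) * t - Real.pi * β (k + 1) / 2) + ((k + 1 : ℕ) : ℝ) * (2 * Real.pi) := by
    ring
  rw [h, Real.cos_add_nat_mul_two_pi]

theorem convClass_periodic {ψ β : ℕ → ℝ} {f : ℝ → ℝ} (hf : f ∈ convClass ψ β) :
    Function.Periodic f (2 * Real.pi) := by
  obtain ⟨a₀, φ, -, -, -, -, h⟩ := hf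
  intro x
  rw [h, h]
  have hk : ∀ t, kernel ψ β (x + 2 * Real.pi - t) = kernel ψ β (x - t) := by
    intro t
    rw [add_sub_right_comm, kernel_periodic]
  simp only [hk]

end TrigInterp

end

/-!
Why the theorem holds. Write `n = m + 1` and `N = 2m + 1` for the number of nodes.

*Aliasing.* On the nodes a harmonic of frequency `k` agrees with any harmonic whose frequency is
congruent to `k` modulo `N`, and the representative of absolute value at most `m` is its interpolant
(`sum_cos_mul_lagrange`). Hence interpolation reproduces the harmonics of frequency below `n`, sends
frequency `n` to `-m`, and leaves an error of at most `2` for each higher one. For `f` in the class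
given by `φ`, the product formula for a difference of cosines turns this into
`f(x) - S̃(f; x) = (2 ψ(n) / π) A sin(N x / 2) sin(γ - x / 2) + O(∑_{ν > n} ψ(ν))`, where `A` and `γ`
are the amplitude and the phase of the harmonic of frequency `n` of `φ`
(`abs_errorKernel_sub_le`, `abs_sub_interp_sub_le`). Since `‖φ‖₁ ≤ 1`, `|A| ≤ 1`; and odd powers of
a cosine, suitably normalised, have mean zero, any prescribed phase, and amplitude as close to `1`
as desired (`peak`).

*The leading term.* It remains to find the supremum over `γ` of the `L_p`-norm of
`sin(N x / 2) sin(γ - x / 2)`. For `p < ∞`, Fubini's theorem gives the average of the `p`-th power of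
this norm over `γ ∈ [0, π]` exactly, and it is the `p`-th power of `(2π)^{-1/p} ‖cos‖_p²`. The norm
is Lipschitz in `γ`, with constant `2π`, and has period `π / N` in `γ`, because translating `x` by a
node distance only changes the sign of the first factor. So all its values lie within
`2π² / N` of `(2π)^{-1/p} ‖cos‖_p²`, uniformly in `p`, and this value is attained
(`normLp_leadTerm_le`, `exists_le_normLp_leadTerm`). For `p = ∞` the supremum is `1`.
-/

noncomputable section

namespace TrigInterp

/-! ### Lagrange interpolation and aliasing -/

theorem IsTrigPoly.add {m : ℕ} {S T : ℝ → ℝ} (hS : IsTrigPoly m S) (hT : IsTrigPoly m T) :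
    IsTrigPoly m (fun x => S x + T x) := by
  obtain ⟨a, b, h⟩ := hS
  obtain ⟨c, d, h'⟩ := hT
  refine ⟨fun k => a k + c k, fun k => b k + d k, fun x => ?_⟩
  simp only [h, h', add_mul, Finset.sum_add_distrib]
  ring

theorem IsTrigPoly.const_mul {m : ℕ} {T : ℝ → ℝ} (r : ℝ) (hT : IsTrigPoly m T) :
    IsTrigPoly m (fun x => r * T x) := by
  obtain ⟨a, b, h⟩ := hT
  refine ⟨fun k => r * a k, fun k => r * b k, fun x => ?_⟩
  simp only [h, mul_add, Finset.mul_sum, mul_assoc]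
  ring

theorem IsTrigPoly.const (m : ℕ) (r : ℝ) : IsTrigPoly m (fun _ => r) :=
  ⟨fun k => if k = 0 then 2 * r else 0, 0, fun x => by
    rw [Finset.sum_eq_zero]
    · simp
    · intro k hk
      have : k ≠ 0 := by have := (Finset.mem_Icc.mp hk).1; omega
      simp [this]⟩

theorem IsTrigPoly.sum {ι : Type*} {m : ℕ} (s : Finset ι) {T : ι → ℝ → ℝ}
    (hT : ∀ i ∈ s, IsTrigPoly m (T i)) : IsTrigPoly m (fun x => ∑ i ∈ s, T i x) := by
  classical
  induction s using Finset.induction_on with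
  | empty => simpa using IsTrigPoly.const m 0
  | insert i s hi ih =>
    simp only [Finset.sum_insert hi]
    exact (hT i (by simp)).add (ih fun j hj => hT j (by simp [hj]))

theorem isTrigPoly_cos_nat {m q : ℕ} (hq : q ≤ m) (c : ℝ) :
    IsTrigPoly m (fun x => Real.cos (q * x - c)) := by
  rcases Nat.eq_zero_or_pos q with rfl | h
  · simpa using IsTrigPoly.const m (Real.cos c)
  · refine ⟨fun k => if k = q then Real.cos c else 0, fun k => if k = q then Real.sin c else 0,
      fun x => ?_⟩
    rw [Finset.sum_eq_single_of_mem q (Finset.mem_Icc.mpr ⟨h, hq⟩)]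
    · simp [h.ne, Real.cos_sub]
      ring
    · intro k _ hk
      simp [hk]

theorem isTrigPoly_cos_int {m : ℕ} {r : ℤ} (hr : |r| ≤ m) (c : ℝ) :
    IsTrigPoly m (fun x => Real.cos (r * x - c)) := by
  obtain ⟨q, rfl | rfl⟩ := r.eq_nat_or_neg
  · exact_mod_cast isTrigPoly_cos_nat (q := q) (by simpa using hr) c
  · have h := isTrigPoly_cos_nat (m := m) (q := q) (by simpa using hr) (-c)
    convert h using 2 with x
    rw [← Real.cos_neg]
    congr 1
    push_cast
    ring

/-- The fundamental trigonometric polynomial of order `m` at the node with index `j`: the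
Dirichlet kernel centred there, normalised to the value `1`. -/
def lagrange (m : ℕ) (j : Fin (2 * m + 1)) (x : ℝ) : ℝ :=
  1 / (2 * m + 1) * (1 + ∑ k ∈ Finset.Icc 1 m,
    2 * Real.cos (k * x - k * node (m + 1) ((j : ℕ) : ℤ)))

theorem isTrigPoly_lagrange (m : ℕ) (j : Fin (2 * m + 1)) : IsTrigPoly m (lagrange m j) := by
  unfold lagrange
  refine IsTrigPoly.const_mul _ ((IsTrigPoly.const m 1).add (IsTrigPoly.sum _ fun k hk => ?_))
  exact (isTrigPoly_cos_nat (Finset.mem_Icc.mp hk).2 _).const_mul 2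

theorem node_fin (m : ℕ) (j : Fin (2 * m + 1)) :
    node (m + 1) ((j : ℕ) : ℤ) = 2 * (j : ℝ) * Real.pi / (2 * m + 1) := by
  rw [node_succ]
  push_cast
  rfl

theorem lagrange_node (m : ℕ) (i j : Fin (2 * m + 1)) :
    lagrange m j (node (m + 1) ((i : ℕ) : ℤ)) = if i = j then 1 else 0 := by
  have hN : (2 * (m : ℝ) + 1) ≠ 0 := by positivity
  unfold lagrange
  rw [← Finset.mul_sum]
  simp only [← mul_sub, node_fin]
  split_ifs with h
  · subst h
    simp
    field_simp
    ring
  · rw [dirichlet_zero m i j h, mul_zero]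

/-- Trigonometric polynomials of order `m` are reproduced by Lagrange interpolation. -/
theorem IsTrigPoly.eq_sum_lagrange {m : ℕ} {T : ℝ → ℝ} (hT : IsTrigPoly m T) (x : ℝ) :
    T x = ∑ j : Fin (2 * m + 1), T (node (m + 1) ((j : ℕ) : ℤ)) * lagrange m j x := by
  have hS : IsTrigPoly m (fun x => ∑ j : Fin (2 * m + 1),
      T (node (m + 1) ((j : ℕ) : ℤ)) * lagrange m j x) :=
    IsTrigPoly.sum _ fun j _ => (isTrigPoly_lagrange m j).const_mul _
  obtain ⟨c, hc⟩ := (isTrigPoly_iff m _).mp hT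
  obtain ⟨d, hd⟩ := (isTrigPoly_iff m _).mp hS
  have hcd : c = d := by
    apply evalNodes_injective m
    ext i
    have h1 := hc (node (m + 1) ((i : ℕ) : ℤ))
    have h2 := hd (node (m + 1) ((i : ℕ) : ℤ))
    simp only [lagrange_node, mul_ite, mul_one, mul_zero, Finset.sum_ite_eq, Finset.mem_univ,
      if_true] at h2
    rw [h1, node_fin] at h2
    exact h2
  rw [hc, hcd]
  exact (hd x).symm

theorem interp_eq_sum_lagrange (m : ℕ) {f : ℝ → ℝ} (hf : Function.Periodic f (2 * Real.pi))
    (x : ℝ) : interp (m + 1) f x =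
      ∑ j : Fin (2 * m + 1), f (node (m + 1) ((j : ℕ) : ℤ)) * lagrange m j x := by
  obtain ⟨h1, h2⟩ := interp_spec (Nat.le_add_left 1 m) hf
  rw [IsTrigPoly.eq_sum_lagrange (m := m) h1 x]
  simp only [h2]

/-- Aliasing: on the `2m+1` nodes a harmonic of frequency `k` coincides with any harmonic whose
frequency `r` is congruent to `k` modulo `2m+1`, so its interpolant is that harmonic as soon as
`|r| ≤ m`. -/
theorem sum_cos_mul_lagrange {m : ℕ} {k r : ℤ} (hr : |r| ≤ m) (hkr : (2 * m + 1 : ℤ) ∣ k - r)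
    (c x : ℝ) :
    ∑ j : Fin (2 * m + 1), Real.cos (k * node (m + 1) ((j : ℕ) : ℤ) - c) * lagrange m j x =
      Real.cos (r * x - c) := by
  rw [IsTrigPoly.eq_sum_lagrange (isTrigPoly_cos_int hr c) x]
  refine Finset.sum_congr rfl fun j _ => ?_
  congr 1
  obtain ⟨q, hq⟩ := hkr
  have hN : (2 * (m : ℝ) + 1) ≠ 0 := by positivity
  have hk : (k : ℝ) = r + (2 * m + 1) * q := by
    have : k = r + (2 * m + 1) * q := by linarith
    exact_mod_cast this
  have : (k : ℝ) * node (m + 1) ((j : ℕ) : ℤ) - c =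
      r * node (m + 1) ((j : ℕ) : ℤ) - c + ((q * (j : ℕ) : ℤ) : ℝ) * (2 * Real.pi) := by
    rw [node_fin, hk]
    push_cast
    field_simp
    ring
  rw [this, Real.cos_add_int_mul_two_pi]

theorem exists_alias (m : ℕ) (k : ℤ) : ∃ r : ℤ, |r| ≤ m ∧ (2 * m + 1 : ℤ) ∣ k - r := by
  have h0 : (0 : ℤ) < 2 * m + 1 := by positivity
  have h1 := Int.emod_lt_of_pos k h0
  have h2 := Int.emod_nonneg k h0.ne'
  by_cases h : k % (2 * m + 1) ≤ m
  · exact ⟨k % (2 * m + 1), by rw [abs_le]; omega, Int.dvd_self_sub_emod⟩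
  · refine ⟨k % (2 * m + 1) - (2 * m + 1), by rw [abs_le]; omega, ?_⟩
    have := Int.dvd_self_sub_emod (x := k) (m := 2 * m + 1)
    rw [← sub_add]
    exact dvd_add this dvd_rfl

/-! ### The kernel of the interpolation error -/

theorem abs_kernel_term_le {ψ : ℕ → ℝ} (hψ : ∀ k, 1 ≤ k → 0 < ψ k) (k : ℕ) (y : ℝ) :
    |ψ (k + 1) * Real.cos y| ≤ ψ (k + 1) := by
  rw [abs_mul, abs_of_pos (hψ _ (Nat.le_add_left 1 k))]
  exact mul_le_of_le_one_right (hψ _ (Nat.le_add_left 1 k)).le (Real.abs_cos_le_one y)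

theorem summable_kernel {ψ : ℕ → ℝ} (hψ : ∀ k, 1 ≤ k → 0 < ψ k) (hs : Summable ψ) (β : ℕ → ℝ)
    (t : ℝ) : Summable fun k : ℕ =>
      ψ (k + 1) * Real.cos (((k + 1 : ℕ) : ℝ) * t - Real.pi * β (k + 1) / 2) :=
  Summable.of_norm_bounded ((summable_nat_add_iff 1).mpr hs) fun k => abs_kernel_term_le hψ k _

theorem continuous_kernel {ψ : ℕ → ℝ} (hψ : ∀ k, 1 ≤ k → 0 < ψ k) (hs : Summable ψ)
    (β : ℕ → ℝ) : Continuous (kernel ψ β) := by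
  unfold kernel
  exact continuous_tsum (fun k => by fun_prop) ((summable_nat_add_iff 1).mpr hs)
    fun k t => abs_kernel_term_le hψ k _

/-- The kernel of the interpolation error: the difference between `x ↦ Ψ_β(x - t)` and its
interpolation polynomial of order `m`. -/
def errorKernel (ψ β : ℕ → ℝ) (m : ℕ) (x t : ℝ) : ℝ :=
  kernel ψ β (x - t) -
    ∑ j : Fin (2 * m + 1), kernel ψ β (node (m + 1) ((j : ℕ) : ℤ) - t) * lagrange m j x

theorem continuous_errorKernel {ψ : ℕ → ℝ} (hψ : ∀ k, 1 ≤ k → 0 < ψ k) (hs : Summable ψ)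
    (β : ℕ → ℝ) (m : ℕ) (x : ℝ) : Continuous (errorKernel ψ β m x) := by
  have := continuous_kernel hψ hs β
  unfold errorKernel
  fun_prop

/-- Up to the tail of the series only the harmonic of frequency `n = m + 1` contributes to the
error: lower ones are reproduced, and this one is interpolated by the harmonic of frequency
`-m`. -/
theorem abs_errorKernel_sub_le {ψ : ℕ → ℝ} (hψ : ∀ k, 1 ≤ k → 0 < ψ k) (hs : Summable ψ)
    (β : ℕ → ℝ) (m : ℕ) (x t : ℝ) :
    |errorKernel ψ β m x t - 2 * ψ (m + 1) * Real.sin ((2 * m + 1) * x / 2) *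
      Real.sin ((m + 1) * t + Real.pi * β (m + 1) / 2 - x / 2)| ≤
      2 * ∑' ν : ℕ, ψ (m + 1 + 1 + ν) := by
  set a : ℕ → ℝ := fun k => ψ (k + 1) *
      Real.cos (((k + 1 : ℕ) : ℝ) * (x - t) - Real.pi * β (k + 1) / 2) -
    ∑ j : Fin (2 * m + 1), ψ (k + 1) * Real.cos (((k + 1 : ℕ) : ℝ) *
      (node (m + 1) ((j : ℕ) : ℤ) - t) - Real.pi * β (k + 1) / 2) * lagrange m j x with ha
  have hsum2 : Summable fun k => ∑ j : Fin (2 * m + 1), ψ (k + 1) *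
      Real.cos (((k + 1 : ℕ) : ℝ) *
      (node (m + 1) ((j : ℕ) : ℤ) - t) - Real.pi * β (k + 1) / 2) * lagrange m j x :=
    summable_sum fun j _ => (summable_kernel hψ hs β _).mul_right _
  have hsa : Summable a := (summable_kernel hψ hs β _).sub hsum2
  have hE : errorKernel ψ β m x t = ∑' k, a k := by
    rw [ha, (summable_kernel hψ hs β _).tsum_sub hsum2,
      Summable.tsum_finsetSum fun j _ => (summable_kernel hψ hs β _).mul_right _]
    simp only [tsum_mul_right]
    rfl
  have hterm : ∀ (k : ℕ) (r : ℤ), |r| ≤ m → (2 * m + 1 : ℤ) ∣ ((k + 1 : ℕ) : ℤ) - r →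
      a k = ψ (k + 1) * (Real.cos (((k + 1 : ℕ) : ℝ) * (x - t) - Real.pi * β (k + 1) / 2) -
        Real.cos (r * x - (((k + 1 : ℕ) : ℝ) * t + Real.pi * β (k + 1) / 2))) := by
    intro k r hr hd
    rw [← sum_cos_mul_lagrange hr hd, mul_sub, Finset.mul_sum]
    simp only [ha, mul_assoc]
    congr 1
    refine Finset.sum_congr rfl fun j _ => ?_
    congr 3
    push_cast
    ring
  have hlow : ∀ k < m, a k = 0 := by
    intro k hk
    rw [hterm k ((k + 1 : ℕ) : ℤ) (by rw [abs_le]; omega) (by simp)]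
    rw [mul_eq_zero, sub_eq_zero]
    right
    congr 1
    push_cast
    ring
  have hmain : a m = 2 * ψ (m + 1) * Real.sin ((2 * m + 1) * x / 2) *
      Real.sin ((m + 1) * t + Real.pi * β (m + 1) / 2 - x / 2) := by
    rw [hterm m (-m) (by simp) ⟨1, by push_cast; ring⟩, Real.cos_sub_cos]
    have e1 : (((m + 1 : ℕ) : ℝ) * (x - t) - Real.pi * β (m + 1) / 2 +
        (((-m : ℤ) : ℝ) * x - (((m + 1 : ℕ) : ℝ) * t + Real.pi * β (m + 1) / 2))) / 2 =
        -((m + 1) * t + Real.pi * β (m + 1) / 2 - x / 2) := by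
      push_cast; ring
    have e2 : (((m + 1 : ℕ) : ℝ) * (x - t) - Real.pi * β (m + 1) / 2 -
        (((-m : ℤ) : ℝ) * x - (((m + 1 : ℕ) : ℝ) * t + Real.pi * β (m + 1) / 2))) / 2 =
        (2 * m + 1) * x / 2 := by
      push_cast; ring
    rw [e1, e2, Real.sin_neg]
    ring
  have htail : ∀ ν, |a (ν + (m + 1))| ≤ 2 * ψ (m + 1 + 1 + ν) := by
    intro ν
    obtain ⟨r, hr, hd⟩ := exists_alias m ((ν + (m + 1) + 1 : ℕ) : ℤ)
    have hp := hψ (ν + (m + 1) + 1) (by omega)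
    rw [hterm _ r hr hd, abs_mul, abs_of_pos hp, show m + 1 + 1 + ν = ν + (m + 1) + 1 by omega,
      mul_comm 2]
    refine mul_le_mul_of_nonneg_left ?_ hp.le
    refine (abs_sub _ _).trans ?_
    linarith [Real.abs_cos_le_one (((ν + (m + 1) + 1 : ℕ) : ℝ) * (x - t) -
      Real.pi * β (ν + (m + 1) + 1) / 2), Real.abs_cos_le_one (r * x -
      (((ν + (m + 1) + 1 : ℕ) : ℝ) * t + Real.pi * β (ν + (m + 1) + 1) / 2))]
  have hs' : Summable fun ν : ℕ => ψ (m + 1 + 1 + ν) :=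
    hs.comp_injective (add_right_injective (m + 1 + 1))
  rw [hE, ← hsa.sum_add_tsum_nat_add (m + 1), Finset.sum_range_succ,
    Finset.sum_eq_zero fun k hk => hlow k (Finset.mem_range.mp hk), zero_add, hmain,
    add_sub_cancel_left, ← tsum_mul_left]
  rw [← Real.norm_eq_abs]
  exact tsum_of_norm_bounded (hs'.mul_left 2).hasSum htail

theorem sum_lagrange (m : ℕ) (x : ℝ) : ∑ j, lagrange m j x = 1 := by
  simpa using ((IsTrigPoly.const m 1).eq_sum_lagrange x).symm

theorem sub_interp_eq_integral {ψ : ℕ → ℝ} (hψ : ∀ k, 1 ≤ k → 0 < ψ k) (hs : Summable ψ)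
    {β : ℕ → ℝ} {f φ : ℝ → ℝ} {a₀ : ℝ} (hf : Function.Periodic f (2 * Real.pi))
    (hφ : IntervalIntegrable φ volume 0 (2 * Real.pi))
    (h : ∀ x : ℝ, f x = a₀ / 2 +
      1 / Real.pi * ∫ t in (0 : ℝ)..(2 * Real.pi), kernel ψ β (x - t) * φ t) (m : ℕ) (x : ℝ) :
    f x - interp (m + 1) f x =
      1 / Real.pi * ∫ t in (0 : ℝ)..(2 * Real.pi), errorKernel ψ β m x t * φ t := by
  have hi : ∀ y, IntervalIntegrable (fun t => kernel ψ β (y - t) * φ t) volume 0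
      (2 * Real.pi) := fun y =>
    hφ.continuousOn_mul ((continuous_kernel hψ hs β).comp (by fun_prop)).continuousOn
  have hE : ∀ t, errorKernel ψ β m x t * φ t = kernel ψ β (x - t) * φ t -
      ∑ j : Fin (2 * m + 1),
        lagrange m j x * (kernel ψ β (node (m + 1) ((j : ℕ) : ℤ) - t) * φ t) := by
    intro t
    rw [errorKernel, sub_mul, Finset.sum_mul]
    congr 1
    exact Finset.sum_congr rfl fun j _ => by ring
  simp only [hE]
  rw [intervalIntegral.integral_sub (hi x) (by
      have := IntervalIntegrable.sum (Finset.univ : Finset (Fin (2 * m + 1)))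
        (f := fun j t => lagrange m j x * (kernel ψ β (node (m + 1) ((j : ℕ) : ℤ) - t) * φ t))
        (fun j _ => (hi (node (m + 1) ((j : ℕ) : ℤ))).const_mul _)
      simpa [Finset.sum_fn] using this),
    intervalIntegral.integral_finsetSum (fun j _ => (hi _).const_mul _),
    interp_eq_sum_lagrange m hf]
  simp only [intervalIntegral.integral_const_mul, h, add_mul, Finset.sum_add_distrib]
  rw [← Finset.mul_sum, sum_lagrange, mul_sub, Finset.mul_sum]
  have : ∀ j : Fin (2 * m + 1), 1 / Real.pi * (lagrange m j x *
      ∫ t in (0 : ℝ)..(2 * Real.pi), kernel ψ β (node (m + 1) ((j : ℕ) : ℤ) - t) * φ t) =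
      1 / Real.pi * (∫ t in (0 : ℝ)..(2 * Real.pi),
        kernel ψ β (node (m + 1) ((j : ℕ) : ℤ) - t) * φ t) * lagrange m j x := fun j => by ring
  simp only [this]
  ring

/-! ### Comparison of norms -/

theorem normLp_mono {p : ENNReal} {f g : ℝ → ℝ} (h : ∀ x, |f x| ≤ |g x|) :
    normLp p f ≤ normLp p g :=
  eLpNorm_mono h

theorem normLp_le_of_abs_le {p : ENNReal} (hp : 1 ≤ p) {f : ℝ → ℝ} {c : ℝ}
    (h : ∀ x, |f x| ≤ c) : normLp p f ≤ ENNReal.ofReal (2 * Real.pi * c) := by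
  have hpi : 1 ≤ 2 * Real.pi := by linarith [Real.pi_gt_three]
  have hq : p.toReal⁻¹ ≤ 1 := by
    rcases eq_or_ne p ⊤ with rfl | hp'
    · simp
    · apply inv_le_one_of_one_le₀
      simpa using ENNReal.toReal_mono hp' hp
  refine (eLpNorm_le_of_ae_bound (C := c) (.of_forall h)).trans ?_
  rw [ENNReal.ofReal_mul (by positivity)]
  gcongr
  simp only [MeasurableSet.univ, Measure.restrict_apply, Set.univ_inter, Real.volume_Ico, sub_zero]
  calc ENNReal.ofReal (2 * Real.pi) ^ p.toReal⁻¹ ≤ ENNReal.ofReal (2 * Real.pi) ^ (1 : ℝ) :=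
        ENNReal.rpow_le_rpow_of_exponent_le (ENNReal.one_le_ofReal.mpr hpi) hq
    _ = _ := ENNReal.rpow_one _

theorem normLp_ne_top {p : ENNReal} (hp : 1 ≤ p) {f : ℝ → ℝ} {c : ℝ}
    (h : ∀ x, |f x| ≤ c) : normLp p f ≠ ⊤ :=
  ne_top_of_le_ne_top ENNReal.ofReal_ne_top (normLp_le_of_abs_le hp h)

theorem normLp_le_add {p : ENNReal} (hp : 1 ≤ p) {f g : ℝ → ℝ} (hg : Continuous g) {c : ℝ}
    (hc : 0 ≤ c) (h : ∀ x, |f x| ≤ |g x| + c) :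
    normLp p f ≤ normLp p g + ENNReal.ofReal (2 * Real.pi * c) := by
  calc normLp p f ≤ normLp p (fun x => |g x| + c) :=
        normLp_mono fun x => (h x).trans (le_abs_self _)
    _ ≤ normLp p (fun x => |g x|) + normLp p (fun _ => c) :=
        eLpNorm_add_le hg.abs.aestronglyMeasurable aestronglyMeasurable_const hp
    _ ≤ _ := add_le_add (normLp_mono fun x => (abs_abs _).le)
        (normLp_le_of_abs_le hp fun _ => (abs_of_nonneg hc).le)

/-- As `normLp_le_add`, with no regularity of the dominating function: the truncation
`max (|f| - c) 0` takes its place in the triangle inequality. -/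
theorem normLp_le_add' {p : ENNReal} (hp : 1 ≤ p) {f g : ℝ → ℝ} (hf : Continuous f) {c : ℝ}
    (hc : 0 ≤ c) (h : ∀ x, |f x| ≤ |g x| + c) :
    normLp p f ≤ normLp p g + ENNReal.ofReal (2 * Real.pi * c) := by
  refine (normLp_le_add hp (g := fun x => max (|f x| - c) 0) (by fun_prop) hc fun x => ?_).trans
    (add_le_add_left (normLp_mono fun x => ?_) _)
  · rw [abs_of_nonneg (le_max_right (|f x| - c) 0)]
    linarith [le_max_left (|f x| - c) 0]
  · rw [abs_of_nonneg (le_max_right (|f x| - c) 0)]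
    exact max_le (by linarith [h x]) (abs_nonneg _)

theorem normLp_const_mul (p : ENNReal) (r : ℝ) (f : ℝ → ℝ) :
    normLp p (fun x => r * f x) = ENNReal.ofReal |r| * normLp p f := by
  have := eLpNorm_const_smul r f p (volume.restrict (Set.Ico 0 (2 * Real.pi)))
  rw [Real.enorm_eq_ofReal_abs] at this
  exact this

theorem normLp_eq_integral {p : ENNReal} (hp : 1 ≤ p) (hp' : p ≠ ⊤) {f : ℝ → ℝ}
    (hf : Continuous f) {c : ℝ} (hc : ∀ x, |f x| ≤ c) : normLp p f =
      ENNReal.ofReal ((∫ x in (0 : ℝ)..(2 * Real.pi), |f x| ^ p.toReal) ^ p.toReal⁻¹) := by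
  have hm : MemLp f p (volume.restrict (Set.Ico 0 (2 * Real.pi))) :=
    ⟨hf.aestronglyMeasurable, (normLp_ne_top hp hc).lt_top⟩
  rw [normLp, hm.eLpNorm_eq_integral_rpow_norm (by positivity) hp',
    intervalIntegral.integral_of_le (by positivity), integral_Ico_eq_integral_Ioc]
  rfl

/-- A continuous function of modulus `1` at an interior point exceeds every smaller bound on a set of
positive measure. -/
theorem one_le_normLp_top {f : ℝ → ℝ} (hf : Continuous f) {x₀ : ℝ} (h0 : 0 < x₀)
    (h1 : x₀ < 2 * Real.pi) (hx : |f x₀| = 1) : 1 ≤ normLp ⊤ f := by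
  by_contra! hlt
  have hae : ∀ᵐ x ∂(volume.restrict (Set.Ico 0 (2 * Real.pi))), ‖f x‖ₑ ≤ normLp ⊤ f := by
    unfold normLp
    rw [eLpNorm_exponent_top]
    exact enorm_ae_le_eLpNormEssSup f _
  have hopen : IsOpen {x | normLp ⊤ f < ‖f x‖ₑ} := isOpen_lt continuous_const hf.enorm
  have hz := ae_iff.mp hae
  simp only [not_le] at hz
  rw [Measure.restrict_apply hopen.measurableSet] at hz
  have hz' : volume ({x | normLp ⊤ f < ‖f x‖ₑ} ∩ Set.Ioo 0 (2 * Real.pi)) = 0 :=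
    measure_mono_null (Set.inter_subset_inter_right _ Set.Ioo_subset_Ico_self) hz
  have he := ((hopen.inter isOpen_Ioo).measure_eq_zero_iff volume).mp hz'
  refine (Set.eq_empty_iff_forall_notMem.mp he x₀) ⟨?_, h0, h1⟩
  simpa [Real.enorm_eq_ofReal_abs, hx] using hlt

theorem normLp_cos_pos {p : ENNReal} (hp : 1 ≤ p) : 0 < (normLp p Real.cos).toReal := by
  refine ENNReal.toReal_pos (fun h => ?_) (normLp_ne_top hp Real.abs_cos_le_one)
  rw [normLp, eLpNorm_eq_zero_iff Real.continuous_cos.aestronglyMeasurable (by positivity)] at h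
  have h2 : ∫ x in (0 : ℝ)..(2 * Real.pi), Real.cos x ^ 2 = 0 := by
    rw [intervalIntegral.integral_of_le (by positivity), ← integral_Ico_eq_integral_Ioc]
    refine (integral_congr_ae (g := fun _ => (0 : ℝ)) ?_).trans (by simp)
    filter_upwards [h] with x hx
    simp [hx]
  rw [integral_cos_sq] at h2
  simp [Real.pi_ne_zero] at h2

/-! ### The norm of the leading term of the error -/

/-- Substitution over a range on which the argument covers `n` periods of `|sin|`. -/
theorem integral_abs_sin_rpow_comp_mul {q : ℝ} (hq : 0 < q) {c : ℝ} (hc : c ≠ 0) (n : ℤ) (d : ℝ) :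
    ∫ x in (0 : ℝ)..(n * Real.pi / c), |Real.sin (c * x + d)| ^ q =
      n / c * ∫ u in (0 : ℝ)..Real.pi, |Real.sin u| ^ q := by
  have hper : Function.Periodic (fun u => |Real.sin u| ^ q) Real.pi := fun u => by
    simp [Real.sin_add_pi]
  have hcont : Continuous fun u => |Real.sin u| ^ q :=
    Real.continuous_sin.abs.rpow_const fun _ => .inr hq.le
  rw [intervalIntegral.integral_comp_mul_add (fun u => |Real.sin u| ^ q) hc d,
    show c * (n * Real.pi / c) + d = (c * 0 + d) + n • Real.pi by
      rw [zsmul_eq_mul]; field_simp; ring,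
    hper.intervalIntegral_add_zsmul_eq n _ (fun _ _ => hcont.intervalIntegrable _ _),
    hper.intervalIntegral_add_eq _ 0, zero_add, zsmul_eq_mul, smul_eq_mul]
  field_simp

/-- The leading term of the error of interpolation at `2m+1` nodes, up to a constant factor, as
a function of the phase `γ`. -/
def leadTerm (m : ℕ) (γ x : ℝ) : ℝ := Real.sin ((2 * m + 1) * x / 2) * Real.sin (γ - x / 2)

/-- The number `(2π)^{-1/p} ‖cos‖_p²`, with `1/p = 0` for `p = ∞`. For finite `p` it is the mean of
order `p` over `γ` of the norms of `leadTerm m γ`, whatever `m`. -/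
def meanNorm (p : ENNReal) : ℝ :=
  (2 * Real.pi) ^ (-(p⁻¹).toReal) * (normLp p Real.cos).toReal ^ 2

theorem mainConst_eq (p : ENNReal) : mainConst p = 2 / Real.pi * meanNorm p := by
  have hpi := Real.pi_pos
  rw [mainConst, meanNorm, Real.rpow_sub two_pos, Real.rpow_add hpi, Real.rpow_neg (by positivity),
    Real.mul_rpow two_pos.le hpi.le, Real.rpow_one, Real.rpow_one]
  field_simp

theorem meanNorm_pos {p : ENNReal} (hp : 1 ≤ p) : 0 < meanNorm p := by
  have := normLp_cos_pos hp
  unfold meanNorm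
  positivity

theorem abs_leadTerm_le (m : ℕ) (γ x : ℝ) : |leadTerm m γ x| ≤ 1 := by
  rw [leadTerm, abs_mul]
  exact mul_le_one₀ (Real.abs_sin_le_one _) (abs_nonneg _) (Real.abs_sin_le_one _)

theorem continuous_leadTerm (m : ℕ) (γ : ℝ) : Continuous (leadTerm m γ) := by
  unfold leadTerm
  fun_prop

theorem meanNorm_top : meanNorm ⊤ = 1 := by
  have h : normLp ⊤ Real.cos = 1 := by
    refine le_antisymm ?_ (one_le_normLp_top Real.continuous_cos Real.pi_pos
      (by linarith [Real.pi_pos]) (by simp))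
    have := eLpNorm_le_of_ae_bound (p := ⊤) (μ := volume.restrict (Set.Ico 0 (2 * Real.pi)))
      (f := Real.cos) (C := 1) (.of_forall Real.abs_cos_le_one)
    simpa [normLp] using this
  simp [meanNorm, h]

/-- Integration over the phase first separates the two factors of `leadTerm`. -/
theorem leadTerm_norm_integral {q : ℝ} (hq : 0 < q) (m : ℕ) :
    ∫ γ in (0 : ℝ)..Real.pi, ∫ x in (0 : ℝ)..(2 * Real.pi), |leadTerm m γ x| ^ q =
      2 * (∫ u in (0 : ℝ)..Real.pi, |Real.sin u| ^ q) ^ 2 := by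
  have hcont : Continuous (Function.uncurry fun γ x => |leadTerm m γ x| ^ q) := by
    refine Continuous.rpow_const ?_ fun _ => .inr hq.le
    unfold leadTerm
    fun_prop
  rw [intervalIntegral_intervalIntegral_swap]
  · have hinner : ∀ x, ∫ γ in (0 : ℝ)..Real.pi, |leadTerm m γ x| ^ q =
        |Real.sin ((2 * m + 1) * x / 2)| ^ q * ∫ u in (0 : ℝ)..Real.pi, |Real.sin u| ^ q := by
      intro x
      have := integral_abs_sin_rpow_comp_mul hq one_ne_zero 1 (-(x / 2))
      simp only [Int.cast_one, one_mul, div_one, ← sub_eq_add_neg] at this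
      rw [← this, ← intervalIntegral.integral_const_mul]
      refine intervalIntegral.integral_congr fun γ _ => ?_
      simp only [leadTerm, abs_mul]
      exact Real.mul_rpow (abs_nonneg _) (abs_nonneg _)
    simp only [hinner]
    rw [intervalIntegral.integral_mul_const]
    have hN : ((2 * m + 1) / 2 : ℝ) ≠ 0 := by positivity
    have := integral_abs_sin_rpow_comp_mul hq hN (2 * m + 1) 0
    have e1 : (((2 * m + 1 : ℤ) : ℝ) * Real.pi / ((2 * m + 1) / 2 : ℝ)) = 2 * Real.pi := by
      push_cast; field_simp
    have e2 : (((2 * m + 1 : ℤ) : ℝ) / ((2 * m + 1) / 2 : ℝ)) = 2 := by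
      push_cast; field_simp
    rw [e1, e2] at this
    simp only [add_zero] at this
    have e3 : ∀ x : ℝ, (2 * (m : ℝ) + 1) * x / 2 = (2 * m + 1) / 2 * x := fun x => by ring
    simp only [e3]
    rw [this]
    ring
  · exact (hcont.continuousOn.integrableOn_compact (isCompact_uIcc.prod isCompact_uIcc)).mono_set
      (Set.prod_mono Set.uIoc_subset_uIcc Set.uIoc_subset_uIcc)

/-- By the mean value theorem some phase `γ` realises the mean norm exactly. -/
theorem exists_normLp_leadTerm_eq {p : ENNReal} (hp : 1 ≤ p) (hp' : p ≠ ⊤) (m : ℕ) :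
    ∃ γ, normLp p (leadTerm m γ) = ENNReal.ofReal (meanNorm p) := by
  have hq1 : 1 ≤ p.toReal := by simpa using ENNReal.toReal_mono hp' hp
  set q := p.toReal with hqdef
  have hq : 0 < q := by linarith
  have hcont : Continuous (Function.uncurry fun γ x => |leadTerm m γ x| ^ q) := by
    refine Continuous.rpow_const ?_ fun _ => .inr hq.le
    unfold leadTerm
    fun_prop
  obtain ⟨γ, -, hγ⟩ := exists_eq_interval_average (a := 0) (b := Real.pi)
    (f := fun γ => ∫ x in (0 : ℝ)..(2 * Real.pi), |leadTerm m γ x| ^ q) Real.pi_ne_zero.symm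
    (intervalIntegral.continuous_parametric_intervalIntegral_of_continuous' hcont _ _).continuousOn
  refine ⟨γ, ?_⟩
  have hcos : normLp p Real.cos = ENNReal.ofReal
      ((2 * ∫ u in (0 : ℝ)..Real.pi, |Real.sin u| ^ q) ^ q⁻¹) := by
    rw [normLp_eq_integral hp hp' Real.continuous_cos Real.abs_cos_le_one]
    have := integral_abs_sin_rpow_comp_mul hq one_ne_zero 2 (Real.pi / 2)
    simp only [one_mul, div_one, Real.sin_add_pi_div_two, Int.cast_ofNat] at this
    rw [← this]
  have hw : 0 ≤ ∫ u in (0 : ℝ)..Real.pi, |Real.sin u| ^ q :=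
    intervalIntegral.integral_nonneg Real.pi_pos.le fun _ _ => by positivity
  rw [normLp_eq_integral hp hp' (continuous_leadTerm m γ) (abs_leadTerm_le m γ), ← hqdef, hγ,
    interval_average_eq_div, leadTerm_norm_integral hq m, meanNorm, hcos]
  set w := ∫ u in (0 : ℝ)..Real.pi, |Real.sin u| ^ q
  have hpi := Real.pi_pos
  rw [ENNReal.toReal_ofReal (by positivity), ENNReal.toReal_inv, ← hqdef,
    Real.rpow_neg (by positivity), ← Real.inv_rpow (by positivity),
    sq ((2 * w) ^ q⁻¹),
    ← Real.mul_rpow (by positivity) (by positivity),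
    ← Real.mul_rpow (by positivity) (by positivity)]
  congr 2
  field_simp
  ring

/-- A translation by a node shifts the phase of `leadTerm`, so that the norm has a small period
in the phase. -/
theorem periodic_normLp_leadTerm {p : ENNReal} (hp : 1 ≤ p) (hp' : p ≠ ⊤) (m : ℕ) :
    Function.Periodic (fun γ => normLp p (leadTerm m γ)) (Real.pi / (2 * m + 1)) := by
  intro γ
  have hN : (2 * (m : ℝ) + 1) ≠ 0 := by positivity
  set δ := γ + Real.pi / (2 * m + 1) with hδ
  have hshift : ∀ x, |leadTerm m γ x| = |leadTerm m δ (x + 2 * Real.pi / (2 * m + 1))| := by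
    intro x
    rw [leadTerm, leadTerm, show (2 * (m : ℝ) + 1) * (x + 2 * Real.pi / (2 * m + 1)) / 2 =
      (2 * m + 1) * x / 2 + Real.pi by field_simp, Real.sin_add_pi,
      show δ - (x + 2 * Real.pi / (2 * m + 1)) / 2 = γ - x / 2 by rw [hδ]; field_simp; ring,
      neg_mul, abs_neg]
  have hper : Function.Periodic (fun x => |leadTerm m δ x| ^ p.toReal) (2 * Real.pi) := by
    intro x
    have e1 : (2 * (m : ℝ) + 1) * (x + 2 * Real.pi) / 2 =
        (2 * m + 1) * x / 2 + Real.pi + m * (2 * Real.pi) := by ring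
    have e2 : δ - (x + 2 * Real.pi) / 2 = δ - x / 2 - Real.pi := by ring
    simp only [leadTerm, e1, e2, Real.sin_add_nat_mul_two_pi, Real.sin_add_pi, Real.sin_sub_pi,
      neg_mul_neg]
  simp only
  rw [normLp_eq_integral hp hp' (continuous_leadTerm m γ) (abs_leadTerm_le m γ),
    normLp_eq_integral hp hp' (continuous_leadTerm m δ) (abs_leadTerm_le m δ)]
  simp only [hshift]
  rw [intervalIntegral.integral_comp_add_right (fun x => |leadTerm m δ x| ^ p.toReal),
    zero_add, add_comm (2 * Real.pi), hper.intervalIntegral_add_eq _ 0, zero_add]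

theorem normLp_leadTerm_le_add {p : ENNReal} (hp : 1 ≤ p) (m : ℕ) (γ δ : ℝ) :
    normLp p (leadTerm m γ) ≤
      normLp p (leadTerm m δ) + ENNReal.ofReal (2 * Real.pi * |γ - δ|) := by
  refine normLp_le_add hp (continuous_leadTerm m δ) (abs_nonneg _) fun x => ?_
  have h : |leadTerm m γ x - leadTerm m δ x| ≤ |γ - δ| := by
    rw [leadTerm, leadTerm, ← mul_sub, abs_mul]
    refine (mul_le_of_le_one_left (abs_nonneg _) (Real.abs_sin_le_one _)).trans ?_
    have := Real.abs_sin_sub_sin_le (γ - x / 2) (δ - x / 2)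
    rwa [sub_sub_sub_cancel_right] at this
  linarith [abs_sub_abs_le_abs_sub (leadTerm m γ x) (leadTerm m δ x)]

/-- The error `2π² / (2m+1)` is the Lipschitz constant `2π` of the norm as a function of the phase,
times its period `π / (2m+1)`. -/
theorem normLp_leadTerm_le {p : ENNReal} (hp : 1 ≤ p) (m : ℕ) (γ : ℝ) :
    normLp p (leadTerm m γ) ≤
      ENNReal.ofReal (meanNorm p + 2 * Real.pi ^ 2 / (2 * m + 1)) := by
  rcases eq_or_ne p ⊤ with rfl | hp'
  · have := eLpNorm_le_of_ae_bound (p := ⊤) (μ := volume.restrict (Set.Ico 0 (2 * Real.pi)))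
      (f := leadTerm m γ) (C := 1) (.of_forall (abs_leadTerm_le m γ))
    refine this.trans ?_
    simp only [ENNReal.toReal_top, inv_zero, ENNReal.rpow_zero, one_mul, meanNorm_top]
    exact ENNReal.ofReal_le_ofReal (le_add_of_nonneg_right (by positivity))
  · obtain ⟨γ₀, h₀⟩ := exists_normLp_leadTerm_eq hp hp' m
    obtain ⟨δ, ⟨hδ1, hδ2⟩, hδ⟩ := (periodic_normLp_leadTerm hp hp' m).exists_mem_Ico
      (by positivity) γ γ₀
    rw [hδ]
    refine (normLp_leadTerm_le_add hp m δ γ₀).trans ?_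
    rw [h₀, ← ENNReal.ofReal_add (meanNorm_pos hp).le (by positivity)]
    refine ENNReal.ofReal_le_ofReal (add_le_add_right ?_ _)
    rw [abs_of_nonneg (by linarith)]
    calc 2 * Real.pi * (δ - γ₀) ≤ 2 * Real.pi * (Real.pi / (2 * m + 1)) := by gcongr; linarith
      _ = _ := by ring

theorem exists_le_normLp_leadTerm {p : ENNReal} (hp : 1 ≤ p) (m : ℕ) :
    ∃ γ, ENNReal.ofReal (meanNorm p) ≤ normLp p (leadTerm m γ) := by
  rcases eq_or_ne p ⊤ with rfl | hp'
  · have hN : (2 * (m : ℝ) + 1) ≠ 0 := by positivity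
    refine ⟨Real.pi / (2 * m + 1) / 2 + Real.pi / 2, ?_⟩
    rw [meanNorm_top, ENNReal.ofReal_one]
    refine one_le_normLp_top (continuous_leadTerm m _) (x₀ := Real.pi / (2 * m + 1))
      (by positivity) ?_ ?_
    · rw [div_lt_iff₀ (by positivity)]
      nlinarith [Real.pi_pos, mul_nonneg Real.pi_pos.le (Nat.cast_nonneg (α := ℝ) m)]
    · rw [leadTerm, add_sub_cancel_left, mul_div_cancel₀ _ hN]
      simp
  · obtain ⟨γ, h⟩ := exists_normLp_leadTerm_eq hp hp' m
    exact ⟨γ, h.ge⟩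

/-! ### The error of one function of the class -/

theorem normLp_one_eq_integral {φ : ℝ → ℝ} (hφ : IntegrableOn φ (Set.Ico 0 (2 * Real.pi)) volume) :
    normLp 1 φ = ENNReal.ofReal (∫ t in (0 : ℝ)..(2 * Real.pi), |φ t|) := by
  rw [normLp, eLpNorm_one_eq_lintegral_enorm, ← ofReal_integral_norm_eq_lintegral_enorm hφ,
    intervalIntegral.integral_of_le (by positivity), integral_Ico_eq_integral_Ioc]
  rfl

theorem intervalIntegrable_of_Ico {φ : ℝ → ℝ}
    (hφ : IntegrableOn φ (Set.Ico 0 (2 * Real.pi)) volume) :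
    IntervalIntegrable φ volume 0 (2 * Real.pi) := by
  rwa [intervalIntegrable_iff_integrableOn_Ico_of_le (by positivity)]

theorem integral_abs_le_one {φ : ℝ → ℝ} (hφ : IntegrableOn φ (Set.Ico 0 (2 * Real.pi)) volume)
    (h1 : normLp 1 φ ≤ 1) : ∫ t in (0 : ℝ)..(2 * Real.pi), |φ t| ≤ 1 := by
  rwa [normLp_one_eq_integral hφ, ENNReal.ofReal_le_one] at h1

/-- The error of interpolation, up to the tail of the series, is `leadTerm` with the amplitude `A`
and phase `γ` of the harmonic of frequency `m + 1` of `φ`. -/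
theorem abs_sub_interp_sub_le {ψ : ℕ → ℝ} (hψ : ∀ k, 1 ≤ k → 0 < ψ k) (hs : Summable ψ)
    {β : ℕ → ℝ} {f φ : ℝ → ℝ} {a₀ : ℝ} (hf : Function.Periodic f (2 * Real.pi))
    (hφ : IntegrableOn φ (Set.Ico 0 (2 * Real.pi)) volume) (h1 : normLp 1 φ ≤ 1)
    (h : ∀ x : ℝ, f x = a₀ / 2 +
      1 / Real.pi * ∫ t in (0 : ℝ)..(2 * Real.pi), kernel ψ β (x - t) * φ t) (m : ℕ) {A γ : ℝ}
    (hc : ∫ t in (0 : ℝ)..(2 * Real.pi),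
      Real.cos ((m + 1) * t + Real.pi * β (m + 1) / 2) * φ t = A * Real.cos γ)
    (hsin : ∫ t in (0 : ℝ)..(2 * Real.pi),
      Real.sin ((m + 1) * t + Real.pi * β (m + 1) / 2) * φ t = A * Real.sin γ) (x : ℝ) :
    |(f x - interp (m + 1) f x) - 2 / Real.pi * ψ (m + 1) * A * leadTerm m γ x| ≤
      2 / Real.pi * ∑' ν : ℕ, ψ (m + 1 + 1 + ν) := by
  have hφi := intervalIntegrable_of_Ico hφ
  have hpi := Real.pi_pos
  set T := ∑' ν : ℕ, ψ (m + 1 + 1 + ν)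
  have hT : 0 ≤ T := tsum_nonneg fun ν => (hψ _ (by omega)).le
  set θ := Real.pi * β (m + 1) / 2 with hθ
  have hlead : ∫ t in (0 : ℝ)..(2 * Real.pi), 2 * ψ (m + 1) * Real.sin ((2 * m + 1) * x / 2) *
      Real.sin ((m + 1) * t + θ - x / 2) * φ t = 2 * ψ (m + 1) * A * leadTerm m γ x := by
    have e : ∀ t, 2 * ψ (m + 1) * Real.sin ((2 * m + 1) * x / 2) *
        Real.sin ((m + 1) * t + θ - x / 2) * φ t =
        2 * ψ (m + 1) * Real.sin ((2 * m + 1) * x / 2) * Real.cos (x / 2) *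
          (Real.sin ((m + 1) * t + θ) * φ t) -
        2 * ψ (m + 1) * Real.sin ((2 * m + 1) * x / 2) * Real.sin (x / 2) *
          (Real.cos ((m + 1) * t + θ) * φ t) := by
      intro t
      rw [Real.sin_sub]
      ring
    simp only [e]
    rw [intervalIntegral.integral_sub, intervalIntegral.integral_const_mul,
      intervalIntegral.integral_const_mul, hc, hsin, leadTerm, Real.sin_sub]
    · ring
    · exact (hφi.continuousOn_mul (by fun_prop)).const_mul _
    · exact (hφi.continuousOn_mul (by fun_prop)).const_mul _
  have hdiff : (f x - interp (m + 1) f x) - 2 / Real.pi * ψ (m + 1) * A * leadTerm m γ x =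
      1 / Real.pi * ∫ t in (0 : ℝ)..(2 * Real.pi), (errorKernel ψ β m x t -
        2 * ψ (m + 1) * Real.sin ((2 * m + 1) * x / 2) *
          Real.sin ((m + 1) * t + θ - x / 2)) * φ t := by
    simp only [sub_mul]
    rw [intervalIntegral.integral_sub, hlead, sub_interp_eq_integral hψ hs hf hφi h m x]
    · ring
    · exact hφi.continuousOn_mul (continuous_errorKernel hψ hs β m x).continuousOn
    · exact hφi.continuousOn_mul (by fun_prop)
  have hint := intervalIntegral.norm_integral_le_of_norm_le (μ := volume)
    (show (0 : ℝ) ≤ 2 * Real.pi by positivity)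
    (f := fun t => (errorKernel ψ β m x t -
        2 * ψ (m + 1) * Real.sin ((2 * m + 1) * x / 2) *
          Real.sin ((m + 1) * t + θ - x / 2)) * φ t)
    (g := fun t => 2 * T * |φ t|) (.of_forall fun t _ => by
      rw [Real.norm_eq_abs, abs_mul]
      exact mul_le_mul_of_nonneg_right (abs_errorKernel_sub_le hψ hs β m x t) (abs_nonneg _))
    (hφi.abs.const_mul _)
  rw [intervalIntegral.integral_const_mul, Real.norm_eq_abs] at hint
  rw [hdiff, abs_mul, abs_of_pos (by positivity : 0 < 1 / Real.pi)]
  calc 1 / Real.pi * _ ≤ 1 / Real.pi * (2 * T * 1) := by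
        refine mul_le_mul_of_nonneg_left (hint.trans ?_) (by positivity)
        exact mul_le_mul_of_nonneg_left (integral_abs_le_one hφ h1) (by positivity)
    _ = _ := by ring

/-- Every harmonic of an admissible `φ` has amplitude at most `1`. -/
theorem exists_amplitude_phase {φ : ℝ → ℝ}
    (hφ : IntegrableOn φ (Set.Ico 0 (2 * Real.pi)) volume) (h1 : normLp 1 φ ≤ 1) (m : ℕ) (θ : ℝ) :
    ∃ A γ : ℝ, |A| ≤ 1 ∧
      ∫ t in (0 : ℝ)..(2 * Real.pi), Real.cos ((m + 1) * t + θ) * φ t = A * Real.cos γ ∧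
      ∫ t in (0 : ℝ)..(2 * Real.pi), Real.sin ((m + 1) * t + θ) * φ t = A * Real.sin γ := by
  have hφi := intervalIntegrable_of_Ico hφ
  set P := ∫ t in (0 : ℝ)..(2 * Real.pi), Real.cos ((m + 1) * t + θ) * φ t with hP
  set Q := ∫ t in (0 : ℝ)..(2 * Real.pi), Real.sin ((m + 1) * t + θ) * φ t with hQ
  set z : ℂ := ⟨P, Q⟩ with hz
  have hzc : ‖z‖ * Real.cos z.arg = P := Complex.norm_mul_cos_arg z
  have hzs : ‖z‖ * Real.sin z.arg = Q := Complex.norm_mul_sin_arg z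
  refine ⟨‖z‖, z.arg, ?_, hzc.symm, hzs.symm⟩
  -- The amplitude is the integral of `φ` against the harmonic with phase `arg z`.
  have hA : ‖z‖ = ∫ t in (0 : ℝ)..(2 * Real.pi), Real.cos ((m + 1) * t + θ - z.arg) * φ t := by
    have e : ∀ t, Real.cos ((m + 1) * t + θ - z.arg) * φ t =
        Real.cos z.arg * (Real.cos ((m + 1) * t + θ) * φ t) +
        Real.sin z.arg * (Real.sin ((m + 1) * t + θ) * φ t) := by
      intro t
      rw [Real.cos_sub]
      ring
    simp only [e]
    rw [intervalIntegral.integral_add, intervalIntegral.integral_const_mul,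
      intervalIntegral.integral_const_mul, ← hP, ← hQ, ← hzc, ← hzs]
    · linear_combination (-‖z‖) * Real.sin_sq_add_cos_sq z.arg
    · exact (hφi.continuousOn_mul (by fun_prop)).const_mul _
    · exact (hφi.continuousOn_mul (by fun_prop)).const_mul _
  have hint := intervalIntegral.norm_integral_le_of_norm_le (μ := volume)
    (show (0 : ℝ) ≤ 2 * Real.pi by positivity)
    (f := fun t => Real.cos ((m + 1) * t + θ - z.arg) * φ t)
    (g := fun t => |φ t|) (.of_forall fun t _ => by
      rw [Real.norm_eq_abs, abs_mul]
      exact mul_le_of_le_one_left (abs_nonneg _) (Real.abs_cos_le_one _))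
    hφi.abs
  rw [← hA, Real.norm_eq_abs] at hint
  exact hint.trans (integral_abs_le_one hφ h1)

/-! ### Nearly extremal functions -/

theorem integral_comp_harmonic {g : ℝ → ℝ} (hg : Function.Periodic g (2 * Real.pi))
    (hc : Continuous g) (m : ℕ) (d : ℝ) :
    ∫ t in (0 : ℝ)..(2 * Real.pi), g ((m + 1) * t + d) = ∫ u in (0 : ℝ)..(2 * Real.pi), g u := by
  have hm : (m : ℝ) + 1 ≠ 0 := by positivity
  rw [intervalIntegral.integral_comp_mul_add g hm d,
    show ((m : ℝ) + 1) * (2 * Real.pi) + d =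
      ((m + 1) * 0 + d) + ((m + 1 : ℕ) : ℤ) • (2 * Real.pi) by simp; ring,
    hg.intervalIntegral_add_zsmul_eq _ _ (fun _ _ => hc.intervalIntegrable _ _),
    hg.intervalIntegral_add_eq _ 0, zero_add]
  simp
  field_simp

theorem integral_cos_pow_odd (k : ℕ) :
    ∫ u in (0 : ℝ)..(2 * Real.pi), Real.cos u ^ (2 * k + 1) = 0 := by
  induction k with
  | zero => simp
  | succ k ih =>
    rw [show 2 * (k + 1) + 1 = 2 * k + 1 + 2 by ring, integral_cos_pow, ih]
    simp

theorem integral_cos_pow_even_succ (k : ℕ) :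
    ∫ u in (0 : ℝ)..(2 * Real.pi), Real.cos u ^ (2 * k + 2) =
      (2 * k + 1) / (2 * k + 2) * ∫ u in (0 : ℝ)..(2 * Real.pi), Real.cos u ^ (2 * k) := by
  rw [integral_cos_pow]
  simp

theorem integral_cos_pow_even_pos (k : ℕ) :
    0 < ∫ u in (0 : ℝ)..(2 * Real.pi), Real.cos u ^ (2 * k) := by
  induction k with
  | zero => simp [Real.pi_pos]
  | succ k ih =>
    rw [mul_add, mul_one, integral_cos_pow_even_succ]
    positivity

theorem integral_sin_mul_cos_pow_odd (k : ℕ) :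
    ∫ u in (0 : ℝ)..(2 * Real.pi), Real.sin u * Real.cos u ^ (2 * k + 1) = 0 := by
  have := integral_sin_pow_mul_cos_pow_odd (a := 0) (b := 2 * Real.pi) 1 k
  simpa using this

/-- A multiple of `cos ^ (2k+1)`, taken at the phase of the harmonic of frequency `m + 1`. As `k`
grows, its mass concentrates where that harmonic is `±1`, with the matching sign. -/
def peak (k m : ℕ) (d t : ℝ) : ℝ :=
  (∫ u in (0 : ℝ)..(2 * Real.pi), Real.cos u ^ (2 * k))⁻¹ * Real.cos ((m + 1) * t + d) ^ (2 * k + 1)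

theorem continuous_peak (k m : ℕ) (d : ℝ) : Continuous (peak k m d) := by
  unfold peak
  fun_prop

theorem periodic_peak (k m : ℕ) (d : ℝ) : Function.Periodic (peak k m d) (2 * Real.pi) := by
  intro t
  have : ((m : ℝ) + 1) * (t + 2 * Real.pi) + d =
      (m + 1) * t + d + ((m + 1 : ℕ) : ℝ) * (2 * Real.pi) := by push_cast; ring
  rw [peak, this, Real.cos_add_nat_mul_two_pi, peak]

theorem integral_peak (k m : ℕ) (d : ℝ) : ∫ t in (0 : ℝ)..(2 * Real.pi), peak k m d t = 0 := by
  unfold peak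
  rw [intervalIntegral.integral_const_mul, integral_comp_harmonic
    (g := fun u => Real.cos u ^ (2 * k + 1)) (fun u => by simp) (by fun_prop),
    integral_cos_pow_odd, mul_zero]

theorem normLp_one_peak_le (k m : ℕ) (d : ℝ) : normLp 1 (peak k m d) ≤ 1 := by
  have hpos := integral_cos_pow_even_pos k
  -- The norm is bounded by `|cos| ^ (2k+1) ≤ cos ^ (2k)`, which is why `peak` is normalised by the
  -- integral of the even power.
  rw [normLp_one_eq_integral ((continuous_peak k m d).integrableOn_Icc.mono_set
    Set.Ico_subset_Icc_self), ENNReal.ofReal_le_one]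
  simp only [peak, abs_mul, abs_inv, abs_of_pos hpos]
  rw [intervalIntegral.integral_const_mul, integral_comp_harmonic
    (g := fun u => |Real.cos u ^ (2 * k + 1)|) (fun u => by simp) (by fun_prop),
    inv_mul_le_iff₀ hpos, mul_one]
  refine intervalIntegral.integral_mono_on (by positivity)
    (Continuous.intervalIntegrable (by fun_prop) _ _)
    (Continuous.intervalIntegrable (by fun_prop) _ _) fun u _ => ?_
  rw [pow_succ, abs_mul, abs_of_nonneg (Even.pow_nonneg (even_two_mul k) _)]
  exact mul_le_of_le_one_right (Even.pow_nonneg (even_two_mul k) _) (Real.abs_cos_le_one u)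

theorem integral_cos_mul_peak (k m : ℕ) (θ γ : ℝ) :
    ∫ t in (0 : ℝ)..(2 * Real.pi), Real.cos ((m + 1) * t + θ) * peak k m (θ - γ) t =
      (2 * k + 1) / (2 * k + 2) * Real.cos γ := by
  have hpos := integral_cos_pow_even_pos k
  set c := ∫ u in (0 : ℝ)..(2 * Real.pi), Real.cos u ^ (2 * k) with hc
  have e : ∀ t, Real.cos ((m + 1) * t + θ) * peak k m (θ - γ) t = c⁻¹ *
      (fun u => Real.cos γ * Real.cos u ^ (2 * k + 2) -
        Real.sin γ * (Real.sin u * Real.cos u ^ (2 * k + 1))) ((m + 1) * t + (θ - γ)) := by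
    intro t
    rw [show ((m : ℝ) + 1) * t + θ = ((m + 1) * t + (θ - γ)) + γ by ring, Real.cos_add, peak, ← hc]
    ring
  simp only [e]
  rw [intervalIntegral.integral_const_mul, integral_comp_harmonic
    (g := fun u => Real.cos γ * Real.cos u ^ (2 * k + 2) -
        Real.sin γ * (Real.sin u * Real.cos u ^ (2 * k + 1))) (fun u => by simp) (by fun_prop),
    intervalIntegral.integral_sub, intervalIntegral.integral_const_mul,
    intervalIntegral.integral_const_mul, integral_sin_mul_cos_pow_odd, integral_cos_pow_even_succ,
    ← hc]
  · field_simp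
    ring
  · exact Continuous.intervalIntegrable (by fun_prop) _ _
  · exact Continuous.intervalIntegrable (by fun_prop) _ _

theorem integral_sin_mul_peak (k m : ℕ) (θ γ : ℝ) :
    ∫ t in (0 : ℝ)..(2 * Real.pi), Real.sin ((m + 1) * t + θ) * peak k m (θ - γ) t =
      (2 * k + 1) / (2 * k + 2) * Real.sin γ := by
  have := integral_cos_mul_peak k m (θ - Real.pi / 2) (γ - Real.pi / 2)
  simpa only [sub_sub_sub_cancel_right, ← add_sub_assoc, Real.cos_sub_pi_div_two] using this

/-! ### Two-sided bounds for the exact upper bound of the errors -/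

/-- Here `4π = (2/π) · 2π²` comes from the norm of `leadTerm`, and `4 = 2π · (2/π)` from the uniform
bound for the remainder. -/
theorem worstError_le {p : ENNReal} (hp : 1 ≤ p) {ψ : ℕ → ℝ} (hψ : ∀ k, 1 ≤ k → 0 < ψ k)
    (hs : Summable ψ) (β : ℕ → ℝ) (m : ℕ) :
    worstError ψ β p (m + 1) ≤ ENNReal.ofReal (mainConst p * ψ (m + 1) +
      4 * Real.pi * ψ (m + 1) / (2 * m + 1) + 4 * ∑' ν : ℕ, ψ (m + 1 + 1 + ν)) := by
  refine iSup₂_le fun f hf => ?_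
  have hper := convClass_periodic hf
  obtain ⟨a₀, φ, -, hφ, -, h1, h⟩ := hf
  have hpi := Real.pi_pos
  have hψm := hψ (m + 1) (by omega)
  have hM := meanNorm_pos hp
  have hT : 0 ≤ ∑' ν : ℕ, ψ (m + 1 + 1 + ν) := tsum_nonneg fun ν => (hψ _ (by omega)).le
  obtain ⟨A, γ, hA, hc, hsin⟩ := exists_amplitude_phase hφ h1 m (Real.pi * β (m + 1) / 2)
  have hb := abs_sub_interp_sub_le hψ hs hper hφ h1 h m hc hsin
  refine (normLp_le_add hp (g := fun x => 2 / Real.pi * ψ (m + 1) * A * leadTerm m γ x)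
    ((continuous_leadTerm m γ).const_mul _)
    (c := 2 / Real.pi * ∑' ν : ℕ, ψ (m + 1 + 1 + ν)) (by positivity) fun x => ?_).trans ?_
  · linarith [hb x, abs_sub_abs_le_abs_sub (f x - interp (m + 1) f x)
      (2 / Real.pi * ψ (m + 1) * A * leadTerm m γ x)]
  · have ha : |2 / Real.pi * ψ (m + 1) * A| ≤ 2 / Real.pi * ψ (m + 1) := by
      rw [abs_mul, abs_of_pos (by positivity : 0 < 2 / Real.pi * ψ (m + 1))]
      exact mul_le_of_le_one_right (by positivity) hA
    rw [normLp_const_mul]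
    refine (add_le_add_left (mul_le_mul' (ENNReal.ofReal_le_ofReal ha)
      (normLp_leadTerm_le hp m γ)) _).trans ?_
    rw [← ENNReal.ofReal_mul (by positivity), ← ENNReal.ofReal_add (by positivity) (by positivity),
      mainConst_eq]
    refine ENNReal.ofReal_le_ofReal (le_of_eq ?_)
    field_simp
    ring

/-- The functions generated by `peak k m` have amplitude `(2k+1)/(2k+2)`, so that the supremum is
approached only in the limit `k → ∞`. -/
theorem le_worstError_add {p : ENNReal} (hp : 1 ≤ p) {ψ : ℕ → ℝ} (hψ : ∀ k, 1 ≤ k → 0 < ψ k)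
    (hs : Summable ψ) (β : ℕ → ℝ) (m : ℕ) :
    mainConst p * ψ (m + 1) ≤
      (worstError ψ β p (m + 1)).toReal + 4 * ∑' ν : ℕ, ψ (m + 1 + 1 + ν) := by
  have hpi := Real.pi_pos
  have hψm := hψ (m + 1) (by omega)
  have hM := meanNorm_pos hp
  have hT : 0 ≤ ∑' ν : ℕ, ψ (m + 1 + 1 + ν) := tsum_nonneg fun ν => (hψ _ (by omega)).le
  have hfin : worstError ψ β p (m + 1) ≠ ⊤ :=
    ne_top_of_le_ne_top ENNReal.ofReal_ne_top (worstError_le hp hψ hs β m)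
  obtain ⟨γ, hγ⟩ := exists_le_normLp_leadTerm hp m
  have hk : ∀ k : ℕ, mainConst p * ψ (m + 1) * ((2 * k + 1) / (2 * k + 2)) ≤
      (worstError ψ β p (m + 1)).toReal + 4 * ∑' ν : ℕ, ψ (m + 1 + 1 + ν) := by
    intro k
    set φ := peak k m (Real.pi * β (m + 1) / 2 - γ)
    have hφ : IntegrableOn φ (Set.Ico 0 (2 * Real.pi)) volume :=
      (continuous_peak k m _).integrableOn_Icc.mono_set Set.Ico_subset_Icc_self
    set f : ℝ → ℝ := fun x => 0 / 2 +
      1 / Real.pi * ∫ t in (0 : ℝ)..(2 * Real.pi), kernel ψ β (x - t) * φ t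
    have hf : f ∈ convClass ψ β := ⟨0, φ, periodic_peak _ _ _, hφ, integral_peak _ _ _,
      normLp_one_peak_le _ _ _, fun _ => rfl⟩
    have hb := abs_sub_interp_sub_le (f := f) hψ hs (convClass_periodic hf) hφ
      (normLp_one_peak_le _ _ _) (fun _ => rfl) m
      (integral_cos_mul_peak k m _ γ) (integral_sin_mul_peak k m _ γ)
    have hle := normLp_le_add' hp
      (f := fun x => 2 / Real.pi * ψ (m + 1) * ((2 * k + 1) / (2 * k + 2)) * leadTerm m γ x)
      (g := fun x => f x - interp (m + 1) f x) ((continuous_leadTerm m γ).const_mul _)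
      (c := 2 / Real.pi * ∑' ν : ℕ, ψ (m + 1 + 1 + ν)) (by positivity) fun x => by
        have := hb x
        rw [abs_sub_comm] at this
        linarith [abs_sub_abs_le_abs_sub
          (2 / Real.pi * ψ (m + 1) * ((2 * k + 1) / (2 * k + 2)) * leadTerm m γ x)
          (f x - interp (m + 1) f x)]
    rw [normLp_const_mul, abs_of_pos (by positivity)] at hle
    have hsup : normLp p (fun x => f x - interp (m + 1) f x) ≤ worstError ψ β p (m + 1) :=
      le_iSup₂ (f := fun f _ => normLp p (fun x => f x - interp (m + 1) f x)) f hf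
    have h2 := ((mul_le_mul_right hγ _).trans hle).trans (add_le_add_left hsup _)
    rw [← ENNReal.ofReal_mul (by positivity)] at h2
    have h3 := ENNReal.toReal_mono (ENNReal.add_ne_top.mpr ⟨hfin, ENNReal.ofReal_ne_top⟩) h2
    rw [ENNReal.toReal_add hfin ENNReal.ofReal_ne_top, ENNReal.toReal_ofReal (by positivity),
      ENNReal.toReal_ofReal (by positivity)] at h3
    rw [mainConst_eq]
    refine le_trans (le_of_eq ?_) (h3.trans (le_of_eq ?_))
    · ring
    · field_simp
      ring
  have hlim : Filter.Tendsto (fun k : ℕ => (2 * (k : ℝ) + 1) / (2 * k + 2)) Filter.atTop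
      (nhds 1) := by
    have h := (tendsto_one_div_add_atTop_nhds_zero_nat (𝕜 := ℝ)).const_mul (1 / 2)
    have h' := h.const_sub 1
    simp only [mul_zero, sub_zero] at h'
    refine h'.congr fun k => ?_
    have : (k : ℝ) + 1 ≠ 0 := by positivity
    field_simp
    ring
  have := hlim.const_mul (mainConst p * ψ (m + 1))
  rw [mul_one] at this
  exact le_of_tendsto' this hk

theorem mainConst_pos {p : ENNReal} (hp : 1 ≤ p) : 0 < mainConst p := by
  have := meanNorm_pos hp
  rw [mainConst_eq]
  positivity

theorem worstError_ne_top {p : ENNReal} (hp : 1 ≤ p) {ψ : ℕ → ℝ} (hψ : ∀ k, 1 ≤ k → 0 < ψ k)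
    (hs : Summable ψ) (β : ℕ → ℝ) {n : ℕ} (hn : 1 ≤ n) : worstError ψ β p n ≠ ⊤ := by
  obtain ⟨m, rfl⟩ : ∃ m, n = m + 1 := ⟨n - 1, by omega⟩
  exact ne_top_of_le_ne_top ENNReal.ofReal_ne_top (worstError_le hp hψ hs β m)

theorem abs_worstError_sub_le {p : ENNReal} (hp : 1 ≤ p) {ψ : ℕ → ℝ}
    (hψ : ∀ k, 1 ≤ k → 0 < ψ k) (hs : Summable ψ) (β : ℕ → ℝ) {n : ℕ} (hn : 1 ≤ n) :
    |(worstError ψ β p n).toReal - mainConst p * ψ n| ≤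
      4 * Real.pi * (ψ n / n + ∑' ν : ℕ, ψ (n + 1 + ν)) := by
  obtain ⟨m, rfl⟩ : ∃ m, n = m + 1 := ⟨n - 1, by omega⟩
  have hψm := hψ (m + 1) hn
  have hpi := Real.pi_gt_three
  have hT : 0 ≤ ∑' ν : ℕ, ψ (m + 1 + 1 + ν) := tsum_nonneg fun ν => (hψ _ (by omega)).le
  have hC := mainConst_pos hp
  have hT4 : 4 * ∑' ν : ℕ, ψ (m + 1 + 1 + ν) ≤ 4 * Real.pi * ∑' ν : ℕ, ψ (m + 1 + 1 + ν) :=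
    mul_le_mul_of_nonneg_right (by linarith) hT
  have hdiv : 4 * Real.pi * ψ (m + 1) / (2 * m + 1) ≤
      4 * Real.pi * (ψ (m + 1) / ((m + 1 : ℕ) : ℝ)) := by
    rw [mul_div_assoc]
    gcongr
    push_cast
    linarith [(Nat.cast_nonneg m : (0 : ℝ) ≤ m)]
  have hup := ENNReal.toReal_mono ENNReal.ofReal_ne_top (worstError_le hp hψ hs β m)
  rw [ENNReal.toReal_ofReal (by positivity)] at hup
  have hlow := le_worstError_add hp hψ hs β m
  have h0 : 0 ≤ 4 * Real.pi * (ψ (m + 1) / ((m + 1 : ℕ) : ℝ)) := by positivity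
  rw [abs_le]
  constructor <;> linarith

/-! ### Rapidly decreasing coefficients -/

/-- If the ratios of consecutive terms tend to zero, the tail of the series is dominated by a
geometric series with a ratio as small as desired. -/
theorem isLittleO_tail {ψ : ℕ → ℝ} (hψ : ∀ k, 1 ≤ k → 0 < ψ k) (hs : Summable ψ)
    (hlim : Filter.Tendsto (fun k : ℕ => ψ (k + 1) / ψ k) Filter.atTop (nhds 0)) :
    Asymptotics.IsLittleO Filter.atTop (fun n : ℕ => ∑' ν : ℕ, ψ (n + 1 + ν)) ψ := by
  refine Asymptotics.isLittleO_iff.mpr fun ε hε => ?_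
  obtain ⟨δ, hδ0, hδ1, hδ⟩ : ∃ δ : ℝ, 0 < δ ∧ δ ≤ 1 / 2 ∧ 2 * δ ≤ ε :=
    ⟨min (1 / 2) (ε / 2), by positivity, min_le_left _ _, by linarith [min_le_right (1 / 2) (ε / 2)]⟩
  obtain ⟨K, hK⟩ := Filter.eventually_atTop.mp (hlim.eventually_le_const hδ0)
  filter_upwards [Filter.eventually_ge_atTop (max K 1)] with n hn
  have hn1 : 1 ≤ n := (le_max_right _ _).trans hn
  have hnK : K ≤ n := (le_max_left _ _).trans hn
  have hstep : ∀ k, n ≤ k → ψ (k + 1) ≤ δ * ψ k := fun k hk =>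
    (div_le_iff₀ (hψ k (hn1.trans hk))).mp (hK k (hnK.trans hk))
  have hgeom : ∀ ν : ℕ, ψ (n + 1 + ν) ≤ δ * ψ n * δ ^ ν := by
    intro ν
    induction ν with
    | zero => simpa using hstep n le_rfl
    | succ ν ih =>
      calc ψ (n + 1 + (ν + 1)) ≤ δ * ψ (n + 1 + ν) := hstep (n + 1 + ν) (by omega)
        _ ≤ δ * (δ * ψ n * δ ^ ν) := by gcongr
        _ = _ := by ring
  have hδ' : δ < 1 := by linarith
  have hle := (hs.comp_injective (add_right_injective (n + 1))).tsum_le_tsum hgeom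
    ((summable_geometric_of_lt_one hδ0.le hδ').mul_left _)
  rw [tsum_mul_left, tsum_geometric_of_lt_one hδ0.le hδ'] at hle
  have hψn := hψ n hn1
  have hinv : (1 - δ)⁻¹ ≤ 2 := by
    rw [inv_le_comm₀ (by linarith) two_pos]
    linarith
  rw [Real.norm_of_nonneg (tsum_nonneg fun ν => (hψ _ (by omega)).le), Real.norm_of_nonneg hψn.le]
  calc _ ≤ δ * ψ n * (1 - δ)⁻¹ := hle
    _ ≤ δ * ψ n * 2 := by gcongr
    _ = 2 * δ * ψ n := by ring
    _ ≤ ε * ψ n := by gcongr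

theorem isLittleO_remainder {p : ENNReal} (hp : 1 ≤ p) {ψ : ℕ → ℝ} (hψ : ∀ k, 1 ≤ k → 0 < ψ k)
    (hs : Summable ψ)
    (hlim : Filter.Tendsto (fun k : ℕ => ψ (k + 1) / ψ k) Filter.atTop (nhds 0)) :
    Asymptotics.IsLittleO Filter.atTop (fun n : ℕ => ψ n / n + ∑' ν : ℕ, ψ (n + 1 + ν))
      (fun n : ℕ => mainConst p * ψ n) := by
  refine Asymptotics.IsLittleO.const_mul_right (mainConst_pos hp).ne' ?_
  refine Asymptotics.IsLittleO.add ?_ (isLittleO_tail hψ hs hlim)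
  have h := (Asymptotics.isLittleO_one_iff ℝ).mpr (tendsto_inv_atTop_nhds_zero_nat (𝕜 := ℝ))
  simpa [div_eq_mul_inv] using (Asymptotics.isBigO_refl ψ Filter.atTop).mul_isLittleO h

end TrigInterp
end

theorem mainTheorem1 :
    (∃ C : ℝ, ∀ (p : ENNReal), 1 ≤ p → ∀ (ψ β : ℕ → ℝ),
      (∀ k : ℕ, 1 ≤ k → 0 < ψ k) → Summable ψ →
      ∀ n : ℕ, 1 ≤ n →
        TrigInterp.worstError ψ β p n ≠ ⊤ ∧
        |(TrigInterp.worstError ψ β p n).toReal - TrigInterp.mainConst p * ψ n| ≤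
          C * (ψ n / n + ∑' ν : ℕ, ψ (n + 1 + ν))) ∧
    (∀ (p : ENNReal), 1 ≤ p → ∀ (ψ β : ℕ → ℝ),
      (∀ k : ℕ, 1 ≤ k → 0 < ψ k) → Summable ψ →
      Filter.Tendsto (fun k : ℕ => ψ (k + 1) / ψ k) Filter.atTop (nhds 0) →
        Asymptotics.IsEquivalent Filter.atTop
          (fun n : ℕ => (TrigInterp.worstError ψ β p n).toReal)
          (fun n : ℕ => TrigInterp.mainConst p * ψ n) ∧
        Asymptotics.IsLittleO Filter.atTop
          (fun n : ℕ => ψ n / n + ∑' ν : ℕ, ψ (n + 1 + ν))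
          (fun n : ℕ => TrigInterp.mainConst p * ψ n)) := by
  refine ⟨⟨4 * Real.pi, fun p hp ψ β hψ hs n hn => ⟨TrigInterp.worstError_ne_top hp hψ hs β hn,
    TrigInterp.abs_worstError_sub_le hp hψ hs β hn⟩⟩, fun p hp ψ β hψ hs hlim => ?_⟩
  have ho := TrigInterp.isLittleO_remainder hp hψ hs hlim
  refine ⟨Asymptotics.IsBigO.trans_isLittleO (.of_bound (4 * Real.pi) ?_) ho, ho⟩
  filter_upwards [Filter.eventually_ge_atTop 1] with n hn
  refine (TrigInterp.abs_worstError_sub_le hp hψ hs β hn).trans ?_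
  gcongr
  exact Real.le_norm_self _
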